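/- Let $a_1,a_2,b_1,b_2$ be non-negative integers with $a_2\ge 1$, let $$f_{a,b}(z_1,z_2)=z_1^{a_1+b_1}\bar z_1^{\,b_1}+z_2^{a_2+b_2}\bar z_2^{\,b_2},$$ and let $X=f_{a,b}^{-1}(0)\subset\mathbb C^2=\mathbb R^4$ (a mixed Pham--Brieskorn surface). Suppose that one of the following holds: - type (1): $a_1\ge 1$ and $a_1+2b_1<a_2+2b_2$; - type (2): $a_1\ge 1$ and $a_1+2b_1=a_2+2b_2$; - type (4): $a_1=0$ and $2b_1>a_2+2b_2$; - type (5): $a_1=0$ and $2b_1=a_2+2b_2$. Then for every connected component $C$ of $X\setminus\{0\}$ the germ $(C\cup\{0\},0)$ is inner bi-Lipschitz equivalent to the germ at the origin of the metric cone $$H_1=\{(x,y,z)\in\mathbb R^3 : x^2+y^2=z^2,\ z\ge 0\}.$$ Here the inner distance between two points of a set is the infimum of the lengths of the rectifiable arcs in the set that join them, and two germs are inner bi-Lipschitz equivalent if they have representatives (intersections with open neighbourhoods of the base points) between which there is a homeomorphism that preserves the base points and is bi-Lipschitz with respect to the inner distances of these representatives. -/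

import Mathlib

open scoped ComplexConjugate NNReal ENNReal

noncomputable section

namespace MixedSurface

/-- The mixed Pham-Brieskorn polynomial `f_{a,b}(z) = ∑ i, z_i ^ (a_i + b_i) * conj(z_i) ^ b_i`. -/
def mixedPhamBrieskorn {n : ℕ} (a b : Fin n → ℕ) (z : EuclideanSpace ℂ (Fin n)) : ℂ :=
  ∑ i, z i ^ (a i + b i) * conj (z i) ^ b i

/-- The zero set `X_{a,b}` of `f_{a,b}` in `ℂ²`, with the Euclidean metric on `ℂ² = ℝ⁴`. -/
def surface (a b : Fin 2 → ℕ) : Set (EuclideanSpace ℂ (Fin 2)) :=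
  {z | mixedPhamBrieskorn a b z = 0}

/-- `(a, b)` is of type (1): `a₁, a₂ ≥ 1` and `a₁ + 2 b₁ < a₂ + 2 b₂`. -/
def IsTypeOne (a b : Fin 2 → ℕ) : Prop :=
  1 ≤ a 1 ∧ 1 ≤ a 0 ∧ a 0 + 2 * b 0 < a 1 + 2 * b 1

/-- `(a, b)` is of type (2): `a₁, a₂ ≥ 1` and `a₁ + 2 b₁ = a₂ + 2 b₂`. -/
def IsTypeTwo (a b : Fin 2 → ℕ) : Prop :=
  1 ≤ a 1 ∧ 1 ≤ a 0 ∧ a 0 + 2 * b 0 = a 1 + 2 * b 1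

/-- `(a, b)` is of type (4): `a₂ ≥ 1`, `a₁ = 0` and `2 b₁ > a₂ + 2 b₂`. -/
def IsTypeFour (a b : Fin 2 → ℕ) : Prop :=
  1 ≤ a 1 ∧ a 0 = 0 ∧ a 1 + 2 * b 1 < 2 * b 0

/-- `(a, b)` is of type (5): `a₂ ≥ 1`, `a₁ = 0` and `2 b₁ = a₂ + 2 b₂`. -/
def IsTypeFive (a b : Fin 2 → ℕ) : Prop :=
  1 ≤ a 1 ∧ a 0 = 0 ∧ 2 * b 0 = a 1 + 2 * b 1

/-- The `β`-horn `{(x, y, z) ∈ ℝ³ : x² + y² = z^{2β}, z ≥ 0}`; `horn 1` is the metric cone. -/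
def horn (β : ℚ) : Set (EuclideanSpace ℝ (Fin 3)) :=
  {p | p 0 ^ 2 + p 1 ^ 2 = p 2 ^ (2 * (β : ℝ)) ∧ 0 ≤ p 2}

/-- The inner (length) metric of `X`: the infimum of the lengths of the paths in `X` from `x` to
`y`. Paths that are not rectifiable have length `∞` and do not affect the infimum; the value is
`∞` if no rectifiable path in `X` joins `x` to `y`. -/
def innerEDist {E : Type*} [PseudoEMetricSpace E] (X : Set E) (x y : E) : ℝ≥0∞ :=
  ⨅ (γ : Path x y) (_ : ∀ t, γ t ∈ X), eVariationOn (fun t => γ t) Set.univ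

/-- The germs `(X, x₀)` and `(Y, y₀)` are inner bi-Lipschitz equivalent: they have representatives
`X ∩ U` and `Y ∩ V` (`U`, `V` open neighbourhoods of the base points) and a homeomorphism between
these that maps `x₀` to `y₀` and is bi-Lipschitz for their inner metrics. -/
def InnerBiLipschitzEquiv {E F : Type*} [PseudoEMetricSpace E] [PseudoEMetricSpace F]
    (X : Set E) (x₀ : E) (Y : Set F) (y₀ : F) : Prop :=
  ∃ (U : Set E) (V : Set F) (hx : x₀ ∈ X ∩ U) (hy : y₀ ∈ Y ∩ V)
    (φ : ↥(X ∩ U) ≃ₜ ↥(Y ∩ V)) (K : ℝ≥0),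
    IsOpen U ∧ IsOpen V ∧ φ ⟨x₀, hx⟩ = ⟨y₀, hy⟩ ∧
    ∀ p q : ↥(X ∩ U),
      innerEDist (Y ∩ V) (φ p : F) (φ q : F) ≤ K * innerEDist (X ∩ U) (p : E) (q : E) ∧
      innerEDist (X ∩ U) (p : E) (q : E) ≤ K * innerEDist (Y ∩ V) (φ p : F) (φ q : F)

end MixedSurface

end

noncomputable section

namespace MixedSurface

open Set Filter Topology unitInterval

/-! In polar form `z ^ (a + b) * conj z ^ b` has modulus `|z| ^ (a + 2b)` and direction `dir z ^ a`.
Let `z i` be the variable with the larger total degree. Away from the origin the equation splits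
into `|z j| = |z i| ^ α` with `α ≥ 1`, and `dir (z i) ^ a i = -dir (z j) ^ a j`. With `d = gcd (a j,
a i)`, `a j = n d` and `a i = m d`, each component is the image of the punctured plane under `r
e^{it} ↦ (A r e^{int}, B r^α e^{imt})`.

This chart (`torusChart`) is Lipschitz on the unit disc because `α ≥ 1`. Since `n ≠ 0`, its
component at `i` already expands distances near each point, with a uniform constant. Local expansion
suffices to bound lengths of paths from below, and images of segments bound inner distances from
above. The inner metric is therefore comparable to the Euclidean metric of the disc; so is that of
`horn 1`. -/

/-! ### Inner distances of parametrized sets. -/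

/-- If `g` expands distances near every point up to the factor `K`, then the endpoints of a path `γ`
are at distance at most `K` times the length of `g ∘ γ`. -/
theorem edist_le_mul_eVariationOn {E F : Type*} [PseudoEMetricSpace E] [PseudoEMetricSpace F]
    {K : ℝ≥0} {g : E → F} (hg : ∀ w, ∀ᶠ w' in 𝓝 w, edist w w' ≤ K * edist (g w) (g w'))
    {γ : I → E} (hγ : Continuous γ) :
    edist (γ 0) (γ 1) ≤ K * eVariationOn (fun t => g (γ t)) univ := by
  set f : I → F := fun t => g (γ t)
  set S : Set I := {t | edist (γ 0) (γ t) ≤ K * eVariationOn f (Icc 0 t)}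
  -- Continuous induction: `S` contains 0 and its own supremum, and one step past the supremum is
  -- possible unless it is 1.
  have step : ∀ s t : I, s ≤ t → s ∈ S → edist (γ s) (γ t) ≤ K * edist (f s) (f t) → t ∈ S := by
    intro s t hst hs h
    have hsplit := eVariationOn.Icc_add_Icc f (s := univ) (a := 0) s.2.1 hst (mem_univ s)
    simp only [univ_inter] at hsplit
    calc edist (γ 0) (γ t) ≤ edist (γ 0) (γ s) + edist (γ s) (γ t) := edist_triangle _ _ _
      _ ≤ K * eVariationOn f (Icc 0 s) + K * eVariationOn f (Icc s t) := by
          refine add_le_add hs (h.trans ?_)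
          gcongr
          exact eVariationOn.edist_le f (left_mem_Icc.2 hst) (right_mem_Icc.2 hst)
      _ = K * eVariationOn f (Icc 0 t) := by rw [← mul_add, hsplit]
  have h0 : (0 : I) ∈ S := by simp [S]
  have near : ∀ t, ∀ᶠ s in 𝓝 t, edist (γ t) (γ s) ≤ K * edist (f t) (f s) := fun t =>
    hγ.continuousAt.eventually (hg (γ t))
  have hsup : sSup S ∈ S := by
    obtain ⟨s, hs, hsS⟩ := mem_closure_iff_nhds.1
      ((isLUB_sSup S).mem_closure ⟨0, h0⟩) _ (near (sSup S))
    refine step s _ (le_sSup hsS) hsS ?_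
    rw [edist_comm, edist_comm (f s)]
    exact hs
  have htop : sSup S = 1 := by
    by_contra hne
    have hlt : sSup S < 1 := lt_of_le_of_ne (sSup S).2.2 hne
    have : (𝓝[>] (sSup S)).NeBot := nhdsGT_neBot_of_exists_gt ⟨1, hlt⟩
    obtain ⟨s, hs, hlt'⟩ := (((near (sSup S)).filter_mono nhdsWithin_le_nhds).and
      (self_mem_nhdsWithin (s := Ioi (sSup S)))).exists
    exact absurd (le_sSup (step _ s (le_of_lt hlt') hsup hs)) (not_le.2 hlt')
  rw [htop] at hsup
  exact hsup.trans (by gcongr; exact eVariationOn.mono f (subset_univ _))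

/-- The inner distance in the image of a convex set under a `K`-Lipschitz map. -/
theorem innerEDist_le_of_lipschitzOnWith {E F : Type*} [NormedAddCommGroup E] [NormedSpace ℝ E]
    [PseudoEMetricSpace F] {K : ℝ≥0} {g : E → F} {D : Set E} (hD : Convex ℝ D)
    (hg : LipschitzOnWith K g D) {X : Set F} (hX : MapsTo g D X) {w w' : E} (hw : w ∈ D)
    (hw' : w' ∈ D) : innerEDist X (g w) (g w') ≤ K * edist w w' := by
  have hmem : ∀ t : I, AffineMap.lineMap w w' (t : ℝ) ∈ D := fun t =>
    hD.lineMap_mem hw hw' t.2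
  have hline : LipschitzWith (nndist w w') (AffineMap.lineMap w w' : ℝ → E) :=
    lipschitzWith_lineMap w w'
  let γ : Path (g w) (g w') :=
    { toFun := fun t => g (AffineMap.lineMap w w' (t : ℝ))
      continuous_toFun := hg.continuousOn.comp_continuous
        (hline.continuous.comp continuous_subtype_val) hmem
      source' := by simp
      target' := by simp }
  refine (iInf₂_le γ fun t => hX (hmem t)).trans ?_
  have h1 : eVariationOn (fun t : I => (t : ℝ)) univ ≤ 1 := by
    have hmono : MonotoneOn (fun t : I => (t : ℝ)) univ := fun _ _ _ _ h => h
    have := (hmono.eVariationOn_eq (mem_univ 0) (mem_univ 1)).le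
    have huniv : Icc (0 : I) 1 = univ := eq_univ_of_forall fun t => ⟨t.2.1, t.2.2⟩
    simpa [huniv] using this
  calc eVariationOn (fun t => γ t) univ
      ≤ K * eVariationOn (fun t : I => AffineMap.lineMap w w' (t : ℝ)) univ :=
        hg.comp_eVariationOn_le (g := fun t : I => AffineMap.lineMap w w' (t : ℝ))
          fun t _ => hmem t
    _ ≤ K * (nndist w w' * eVariationOn (fun t : I => (t : ℝ)) univ) := by
        gcongr
        exact (hline.lipschitzOnWith (s := univ)).comp_eVariationOn_le fun _ _ => mem_univ _
    _ ≤ K * edist w w' := by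
        rw [edist_nndist]
        gcongr
        exact mul_le_of_le_one_right' h1

/-- The inner distance in the image of a set under an embedding that expands distances near every
point up to the factor `K`. -/
theorem edist_le_mul_innerEDist {E F : Type*} [PseudoEMetricSpace E] [PseudoEMetricSpace F]
    {K : ℝ≥0} (hK : K ≠ 0) {g : E → F} (hemb : IsEmbedding g)
    (hg : ∀ w, ∀ᶠ w' in 𝓝 w, edist w w' ≤ K * edist (g w) (g w'))
    {X : Set F} (hX : X ⊆ range g) (w w' : E) :
    edist w w' ≤ K * innerEDist X (g w) (g w') := by
  -- If no path exists the infimum is `∞`, and `0 * ∞ = 0` would spoil the bound.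
  have hK' : (K : ℝ≥0∞) ≠ 0 := by exact_mod_cast hK
  simp only [innerEDist, ENNReal.mul_iInf_of_ne hK' ENNReal.coe_ne_top]
  refine le_iInf₂ fun γ hγ => ?_
  -- The path is lifted through the embedding to the parameter space.
  choose c hc using fun t => hX (hγ t)
  have hcont : Continuous c := by
    rw [hemb.continuous_iff]
    exact γ.continuous.congr fun t => (hc t).symm
  have h := edist_le_mul_eVariationOn hg hcont
  have h0 : c 0 = w := hemb.injective (by rw [hc, γ.source])
  have h1 : c 1 = w' := hemb.injective (by rw [hc, γ.target])
  simpa only [h0, h1, hc] using h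

/-! ### Disc charts and their comparison. -/

/-- `g` parametrizes the germ of `X` at `g 0` by the unit disc: it is an embedding of `ℂ` that is
bi-Lipschitz onto its image with respect to the inner distances. -/
structure IsDiscChart {F : Type*} [PseudoEMetricSpace F] (g : ℂ → F) (K : ℝ≥0) (X U : Set F) :
    Prop where
  ne_zero : K ≠ 0
  isEmbedding : IsEmbedding g
  isOpen : IsOpen U
  image_eq : g '' Metric.ball 0 1 = X ∩ U
  lipschitz : LipschitzOnWith K g (Metric.ball 0 1)
  expanding : ∀ w, ∀ᶠ w' in 𝓝 w, edist w w' ≤ K * edist (g w) (g w')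

/-- Both inner distances are compared with the Euclidean distance of the common convex disc, so the
constants multiply. -/
theorem IsDiscChart.innerBiLipschitzEquiv {E F : Type*} [PseudoEMetricSpace E]
    [PseudoEMetricSpace F] {g : ℂ → E} {h : ℂ → F} {K L : ℝ≥0} {X U : Set E} {Y V : Set F}
    (hg : IsDiscChart g K X U) (hh : IsDiscChart h L Y V) :
    InnerBiLipschitzEquiv X (g 0) Y (h 0) := by
  set D : Set ℂ := Metric.ball 0 1
  have h0 : (0 : ℂ) ∈ D := Metric.mem_ball_self one_pos
  let φ : ↥(X ∩ U) ≃ₜ D :=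
    (Homeomorph.setCongr hg.image_eq.symm).trans (hg.isEmbedding.homeomorphImage D).symm
  let ψ : D ≃ₜ ↥(Y ∩ V) :=
    (hh.isEmbedding.homeomorphImage D).trans (Homeomorph.setCongr hh.image_eq)
  have hφ : ∀ w : D, (φ.symm w : E) = g w := fun w => rfl
  have hψ : ∀ w : D, (ψ w : F) = h w := fun w => rfl
  have hmaps : MapsTo g D (X ∩ U) := mapsTo_iff_image_subset.2 hg.image_eq.subset
  have hmaps' : MapsTo h D (Y ∩ V) := mapsTo_iff_image_subset.2 hh.image_eq.subset
  have hD : Convex ℝ D := convex_ball _ _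
  have hrange : X ∩ U ⊆ range g := hg.image_eq ▸ image_subset_range _ _
  have hrange' : Y ∩ V ⊆ range h := hh.image_eq ▸ image_subset_range _ _
  refine ⟨U, V, hmaps h0, hmaps' h0, φ.trans ψ, K * L, hg.isOpen, hh.isOpen, ?_, ?_⟩
  · have : φ ⟨g 0, hmaps h0⟩ = ⟨0, h0⟩ := by
      rw [← φ.eq_symm_apply]
      rfl
    rw [Homeomorph.trans_apply, this]
    rfl
  · intro p q
    obtain ⟨w, rfl⟩ := φ.symm.surjective p
    obtain ⟨w', rfl⟩ := φ.symm.surjective q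
    simp only [Homeomorph.trans_apply, Homeomorph.apply_symm_apply, hφ, hψ]
    push_cast
    constructor
    · calc _ ≤ L * edist (w : ℂ) w' :=
            innerEDist_le_of_lipschitzOnWith hD hh.lipschitz hmaps' w.2 w'.2
        _ ≤ L * (K * innerEDist (X ∩ U) (g w) (g w')) := by
            gcongr
            exact edist_le_mul_innerEDist hg.ne_zero hg.isEmbedding hg.expanding hrange _ _
        _ = _ := by ring
    · calc _ ≤ K * edist (w : ℂ) w' :=
            innerEDist_le_of_lipschitzOnWith hD hg.lipschitz hmaps w.2 w'.2
        _ ≤ K * (L * innerEDist (Y ∩ V) (h w) (h w')) := by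
            gcongr
            exact edist_le_mul_innerEDist hh.ne_zero hh.isEmbedding hh.expanding hrange' _ _
        _ = _ := by ring

/-! ### The metric cone as a disc. -/

/-- The parametrization of the cone over the complex plane. -/
def coneChart (w : ℂ) : EuclideanSpace ℝ (Fin 3) := !₂[w.re, w.im, ‖w‖]

theorem norm_coneChart_sub_sq (w w' : ℂ) :
    ‖coneChart w - coneChart w'‖ ^ 2 = ‖w - w'‖ ^ 2 + (‖w‖ - ‖w'‖) ^ 2 := by
  rw [EuclideanSpace.norm_sq_eq, Fin.sum_univ_three, Complex.sq_norm, Complex.normSq_apply]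
  simp [coneChart]
  ring

theorem norm_sub_le_norm_coneChart_sub (w w' : ℂ) :
    ‖w - w'‖ ≤ ‖coneChart w - coneChart w'‖ := by
  refine le_of_sq_le_sq ?_ (norm_nonneg _)
  rw [norm_coneChart_sub_sq]
  nlinarith [sq_nonneg (‖w‖ - ‖w'‖)]

theorem lipschitzWith_coneChart : LipschitzWith 2 coneChart := by
  refine LipschitzWith.of_dist_le_mul fun w w' => ?_
  rw [dist_eq_norm, dist_eq_norm]
  refine le_of_sq_le_sq ?_ (by positivity)
  rw [norm_coneChart_sub_sq, mul_pow]
  have := sq_le_sq' (by linarith [abs_le.1 (abs_norm_sub_norm_le w w')])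
    (abs_le.1 (abs_norm_sub_norm_le w w')).2
  push_cast
  nlinarith [sq_nonneg ‖w - w'‖]

theorem isDiscChart_coneChart :
    IsDiscChart coneChart 2 (horn 1) {p : EuclideanSpace ℝ (Fin 3) | p 2 < 1} where
  ne_zero := two_ne_zero
  isEmbedding := by
    refine AntilipschitzWith.isEmbedding (K := 1) ?_ lipschitzWith_coneChart.continuous
    refine AntilipschitzWith.of_le_mul_dist fun w w' => ?_
    simpa [dist_eq_norm] using norm_sub_le_norm_coneChart_sub w w'
  isOpen := isOpen_lt (by fun_prop) continuous_const
  image_eq := by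
    ext p
    simp only [horn, mem_image, Metric.mem_ball, dist_zero_right, mem_inter_iff, mem_ofPred_eq,
      Rat.cast_one, mul_one, Real.rpow_two]
    constructor
    · rintro ⟨w, hw, rfl⟩
      refine ⟨⟨?_, norm_nonneg w⟩, hw⟩
      simp [coneChart, Complex.sq_norm, Complex.normSq_apply]
      ring
    · rintro ⟨⟨hp, h0⟩, h1⟩
      have hn : ‖(⟨p 0, p 1⟩ : ℂ)‖ = p 2 := by
        rw [← sq_eq_sq₀ (norm_nonneg _) h0, Complex.sq_norm, Complex.normSq_mk, ← hp]
        ring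
      refine ⟨⟨p 0, p 1⟩, hn.trans_lt h1, ?_⟩
      ext k
      fin_cases k <;> simp [coneChart, hn]
  lipschitz := lipschitzWith_coneChart.lipschitzOnWith
  expanding w := Eventually.of_forall fun w' => by
    have h : edist w w' ≤ edist (coneChart w) (coneChart w') := by
      rw [edist_dist, edist_dist, dist_eq_norm, dist_eq_norm]
      exact ENNReal.ofReal_le_ofReal (norm_sub_le_norm_coneChart_sub w w')
    exact h.trans (le_mul_of_one_le_left' (by norm_num))

theorem coneChart_zero : coneChart 0 = 0 := by
  ext k
  fin_cases k <;> simp [coneChart]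

/-! ### Polar coordinates and twist maps. -/

/-- The direction `w / |w|` of a complex number (zero at the origin). -/
def dir (w : ℂ) : ℂ := w / ‖w‖

theorem dir_zero : dir 0 = 0 := by simp [dir]

theorem norm_mul_dir (w : ℂ) : ‖w‖ * dir w = w := by
  rcases eq_or_ne w 0 with rfl | hw
  · simp
  · rw [dir, mul_div_cancel₀]
    simpa using hw

theorem norm_dir {w : ℂ} (hw : w ≠ 0) : ‖dir w‖ = 1 := by
  rw [dir, norm_div, Complex.norm_real, norm_norm, div_self (norm_ne_zero_iff.2 hw)]

theorem norm_dir_le (w : ℂ) : ‖dir w‖ ≤ 1 := by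
  rcases eq_or_ne w 0 with rfl | hw
  · simp [dir_zero]
  · exact (norm_dir hw).le

theorem dir_ne_zero {w : ℂ} (hw : w ≠ 0) : dir w ≠ 0 := by
  rw [← norm_ne_zero_iff, norm_dir hw]
  exact one_ne_zero

theorem dir_ofReal_mul {r : ℝ} (hr : 0 < r) {c : ℂ} (hc : ‖c‖ = 1) : dir (r * c) = c := by
  have : (r : ℂ) ≠ 0 := by exact_mod_cast hr.ne'
  rw [dir, norm_mul, hc, Complex.norm_real, Real.norm_of_nonneg hr.le, mul_one,
    mul_div_cancel_left₀ _ this]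

theorem continuousAt_dir {w : ℂ} (hw : w ≠ 0) : ContinuousAt dir w := by
  unfold dir
  refine continuousAt_id.div (by fun_prop) ?_
  simpa using hw

/-- The direction varies at rate at most `2 / ‖w‖`; multiplying by the radius keeps the bound valid
at the origin. -/
theorem norm_mul_norm_dir_sub_le (w w' : ℂ) : ‖w‖ * ‖dir w - dir w'‖ ≤ 2 * ‖w - w'‖ := by
  have key : (‖w‖ : ℂ) * (dir w - dir w') = (w - w') + (‖w'‖ - ‖w‖ : ℝ) * dir w' := by
    push_cast
    linear_combination norm_mul_dir w - norm_mul_dir w'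
  calc ‖w‖ * ‖dir w - dir w'‖ = ‖(‖w‖ : ℂ) * (dir w - dir w')‖ := by
        rw [norm_mul, Complex.norm_real, norm_norm]
    _ ≤ ‖w - w'‖ + |‖w'‖ - ‖w‖| * ‖dir w'‖ := by
        rw [key]
        refine (norm_add_le _ _).trans_eq ?_
        rw [norm_mul, Complex.norm_real, Real.norm_eq_abs]
    _ ≤ ‖w - w'‖ + ‖w - w'‖ * 1 := by
        gcongr
        · rw [norm_sub_rev]
          exact abs_norm_sub_norm_le w' w
        · exact norm_dir_le w'
    _ = 2 * ‖w - w'‖ := by ring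

theorem norm_pow_sub_pow_le {x y : ℂ} (hx : ‖x‖ ≤ 1) (hy : ‖y‖ ≤ 1) (m : ℕ) :
    ‖x ^ m - y ^ m‖ ≤ m * ‖x - y‖ := by
  induction m with
  | zero => simp
  | succ k ih =>
    have key : x ^ (k + 1) - y ^ (k + 1) = x ^ k * (x - y) + (x ^ k - y ^ k) * y := by ring
    have hxk : ‖x ^ k‖ ≤ 1 := by
      rw [norm_pow]
      exact pow_le_one₀ (norm_nonneg _) hx
    calc ‖x ^ (k + 1) - y ^ (k + 1)‖ ≤ ‖x ^ k‖ * ‖x - y‖ + ‖x ^ k - y ^ k‖ * ‖y‖ := by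
          rw [key]
          exact (norm_add_le _ _).trans_eq (by rw [norm_mul, norm_mul])
      _ ≤ 1 * ‖x - y‖ + (k * ‖x - y‖) * 1 := by gcongr
      _ = _ := by push_cast; ring

/-- In polar coordinates, the map `(r, t) ↦ (r ^ α, m t)`. -/
def twist (α : ℝ) (m : ℕ) (w : ℂ) : ℂ := (‖w‖ ^ α : ℝ) * dir w ^ m

theorem twist_zero {α : ℝ} (hα : α ≠ 0) (m : ℕ) : twist α m 0 = 0 := by
  simp [twist, Real.zero_rpow hα]

theorem norm_twist {α : ℝ} (hα : α ≠ 0) (m : ℕ) (w : ℂ) : ‖twist α m w‖ = ‖w‖ ^ α := by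
  rcases eq_or_ne w 0 with rfl | hw
  · simp [twist_zero hα, Real.zero_rpow hα]
  · rw [twist, norm_mul, norm_pow, norm_dir hw, Complex.norm_real, one_pow, mul_one,
      Real.norm_of_nonneg (by positivity)]

theorem norm_twist_one (m : ℕ) (w : ℂ) : ‖twist 1 m w‖ = ‖w‖ := by
  rw [norm_twist one_ne_zero, Real.rpow_one]

theorem dir_mul_twist {c w : ℂ} (hc : ‖c‖ = 1) (hw : w ≠ 0) (α : ℝ) (m : ℕ) :
    dir (c * twist α m w) = c * dir w ^ m := by
  rw [twist, mul_left_comm]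
  refine dir_ofReal_mul (Real.rpow_pos_of_pos (norm_pos_iff.2 hw) _) ?_
  rw [norm_mul, hc, norm_pow, norm_dir hw, one_pow, one_mul]

theorem continuous_twist {α : ℝ} (hα : 0 < α) (m : ℕ) : Continuous (twist α m) := by
  rw [continuous_iff_continuousAt]
  intro w
  rcases eq_or_ne w 0 with rfl | hw
  · rw [ContinuousAt, twist_zero hα.ne', tendsto_zero_iff_norm_tendsto_zero]
    simp only [norm_twist hα.ne']
    have : Continuous fun w : ℂ => ‖w‖ ^ α := continuous_norm.rpow_const fun _ => Or.inr hα.le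
    simpa [Real.zero_rpow hα.ne'] using this.tendsto 0
  · refine ContinuousAt.mul ?_ ((continuousAt_dir hw).pow m)
    exact (Complex.continuous_ofReal.comp
      (continuous_norm.rpow_const fun _ => Or.inr hα.le)).continuousAt

theorem exists_abs_rpow_sub_rpow_le {α : ℝ} (hα : 1 ≤ α) :
    ∃ L : ℝ≥0, ∀ r ∈ Icc (0 : ℝ) 1, ∀ s ∈ Icc (0 : ℝ) 1, |r ^ α - s ^ α| ≤ L * |r - s| := by
  have h : ContDiff ℝ 1 fun r : ℝ => r ^ α := Real.contDiff_rpow_const_of_le (by exact_mod_cast hα)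
  obtain ⟨L, hL⟩ := h.contDiffOn.exists_lipschitzOnWith (s := Icc (0 : ℝ) 1) one_ne_zero
    (convex_Icc _ _) isCompact_Icc
  exact ⟨L, fun r hr s hs => hL.dist_le_mul r hr s hs⟩

/-- The radial part is `C¹` since `α ≥ 1`. In the angular part `‖w'‖ ^ α ≤ ‖w'‖` absorbs the blow-up
of `dir` at the origin. -/
theorem exists_lipschitzOnWith_twist {α : ℝ} (hα : 1 ≤ α) (m : ℕ) :
    ∃ L : ℝ≥0, LipschitzOnWith L (twist α m) (Metric.ball 0 1) := by
  obtain ⟨L, hL⟩ := exists_abs_rpow_sub_rpow_le hα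
  refine ⟨L + 2 * m, LipschitzOnWith.of_dist_le_mul fun w hw w' hw' => ?_⟩
  rw [mem_ball_zero_iff] at hw hw'
  have key : twist α m w - twist α m w' =
      (‖w‖ ^ α - ‖w'‖ ^ α : ℝ) * dir w ^ m + (‖w'‖ ^ α : ℝ) * (dir w ^ m - dir w' ^ m) := by
    simp only [twist]
    push_cast
    ring
  have hpow : ‖w'‖ ^ α ≤ ‖w'‖ := by
    simpa using Real.rpow_le_rpow_of_exponent_ge' (norm_nonneg w') hw'.le zero_le_one hα
  have hdir := norm_mul_norm_dir_sub_le w' w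
  rw [norm_sub_rev, norm_sub_rev w'] at hdir
  rw [dist_eq_norm, dist_eq_norm, key]
  calc _ ≤ |‖w‖ ^ α - ‖w'‖ ^ α| * ‖dir w ^ m‖ + ‖w'‖ ^ α * ‖dir w ^ m - dir w' ^ m‖ := by
        refine (norm_add_le _ _).trans_eq ?_
        rw [norm_mul, norm_mul, Complex.norm_real, Complex.norm_real, Real.norm_eq_abs,
          Real.norm_of_nonneg (Real.rpow_nonneg (norm_nonneg _) _)]
    _ ≤ (L * |‖w‖ - ‖w'‖|) * 1 + ‖w'‖ * (m * ‖dir w - dir w'‖) := by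
        gcongr
        · exact hL _ ⟨norm_nonneg _, hw.le⟩ _ ⟨norm_nonneg _, hw'.le⟩
        · rw [norm_pow]
          exact pow_le_one₀ (norm_nonneg _) (norm_dir_le w)
        · exact norm_pow_sub_pow_le (norm_dir_le w) (norm_dir_le w') m
    _ = L * |‖w‖ - ‖w'‖| + m * (‖w'‖ * ‖dir w - dir w'‖) := by ring
    _ ≤ L * ‖w - w'‖ + m * (2 * ‖w - w'‖) := by
        gcongr
        exact abs_norm_sub_norm_le w w'
    _ = _ := by push_cast; ring

/-- The cofactor of `x - y` in `x ^ n - y ^ n` has norm `n ≥ 1` at `y = x`, hence exceeds `1/2`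
nearby. -/
theorem eventually_norm_sub_le_norm_pow_sub_pow {n : ℕ} (hn : n ≠ 0) {x : ℂ} (hx : ‖x‖ = 1) :
    ∀ᶠ y in 𝓝 x, ‖x - y‖ ≤ 2 * ‖x ^ n - y ^ n‖ := by
  have hcont : Continuous fun y : ℂ => ‖∑ i ∈ Finset.range n, x ^ i * y ^ (n - 1 - i)‖ := by
    fun_prop
  have hval : ‖∑ i ∈ Finset.range n, x ^ i * x ^ (n - 1 - i)‖ = n := by
    rw [geom_sum₂_self, norm_mul, norm_pow, hx, one_pow, mul_one]
    simp
  have hlt : (1 / 2 : ℝ) < ‖∑ i ∈ Finset.range n, x ^ i * x ^ (n - 1 - i)‖ := by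
    rw [hval]
    have : (1 : ℝ) ≤ n := by exact_mod_cast Nat.one_le_iff_ne_zero.2 hn
    linarith
  filter_upwards [hcont.continuousAt.eventually (lt_mem_nhds hlt)] with y hy
  rw [← (Commute.all x y).geom_sum₂_mul, norm_mul]
  nlinarith [norm_nonneg (x - y)]

/-- The radial difference costs 1. The angular one costs `2 * 2`: one factor from extracting `n`-th
roots, one from passing to directions. Only the neighbourhood depends on `w`. -/
theorem eventually_norm_sub_le_twist {n : ℕ} (hn : n ≠ 0) (w : ℂ) :
    ∀ᶠ w' in 𝓝 w, ‖w - w'‖ ≤ 5 * ‖twist 1 n w - twist 1 n w'‖ := by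
  rcases eq_or_ne w 0 with rfl | hw
  · refine Eventually.of_forall fun w' => ?_
    rw [twist_zero one_ne_zero, zero_sub, zero_sub, norm_neg, norm_neg, norm_twist_one]
    linarith [norm_nonneg w']
  · filter_upwards [(continuousAt_dir hw).eventually
      (eventually_norm_sub_le_norm_pow_sub_pow hn (norm_dir hw)), eventually_ne_nhds hw]
      with w' hpow hw'
    have hdir := norm_mul_norm_dir_sub_le (1 * twist 1 n w) (1 * twist 1 n w')
    rw [dir_mul_twist norm_one hw, dir_mul_twist norm_one hw', one_mul, one_mul, one_mul, one_mul,
      norm_twist_one] at hdir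
    have hnorm := abs_norm_sub_norm_le (twist 1 n w) (twist 1 n w')
    rw [norm_twist_one, norm_twist_one] at hnorm
    have key : w - w' = (‖w‖ - ‖w'‖ : ℝ) * dir w' + ‖w‖ * (dir w - dir w') := by
      push_cast
      linear_combination norm_mul_dir w' - norm_mul_dir w
    calc ‖w - w'‖ ≤ |‖w‖ - ‖w'‖| * ‖dir w'‖ + ‖w‖ * ‖dir w - dir w'‖ := by
          conv_lhs => rw [key]
          refine (norm_add_le _ _).trans_eq ?_
          rw [norm_mul, norm_mul, Complex.norm_real, Complex.norm_real, Real.norm_eq_abs,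
            norm_norm]
      _ ≤ |‖w‖ - ‖w'‖| * 1 + ‖w‖ * (2 * ‖dir w ^ n - dir w' ^ n‖) := by
          gcongr
          exact norm_dir_le w'
      _ ≤ 5 * ‖twist 1 n w - twist 1 n w'‖ := by linarith

/-! ### Coordinates of `ℂ²` and coprime exponents. -/

theorem eq_or_eq_of_ne {i j : Fin 2} (hij : i ≠ j) (k : Fin 2) : k = i ∨ k = j := by
  omega

theorem norm_le_add_norm_apply {i j : Fin 2} (hij : i ≠ j) (z : EuclideanSpace ℂ (Fin 2)) :
    ‖z‖ ≤ ‖z i‖ + ‖z j‖ := by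
  have hsum : ‖z‖ ^ 2 = ‖z i‖ ^ 2 + ‖z j‖ ^ 2 := by
    have huniv : (Finset.univ : Finset (Fin 2)) = {i, j} := by
      ext k
      simpa using eq_or_eq_of_ne hij k
    rw [EuclideanSpace.norm_sq_eq, huniv, Finset.sum_pair hij]
  refine le_of_sq_le_sq ?_ (by positivity)
  nlinarith [mul_nonneg (norm_nonneg (z i)) (norm_nonneg (z j))]

theorem pow_eq_one_of_coprime {n m : ℕ} (h : n.Coprime m) {x : ℂ} (hn : x ^ n = 1)
    (hm : x ^ m = 1) : x = 1 := by
  have := Nat.dvd_gcd (orderOf_dvd_of_pow_eq_one hn) (orderOf_dvd_of_pow_eq_one hm)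
  rw [h.gcd_eq_one, Nat.dvd_one, orderOf_eq_one_iff] at this
  exact this

/-- The curve `s ^ m = t ^ n` with coprime exponents is parametrized by `(ζ ^ n, ζ ^ m)`. -/
theorem exists_pow_eq_pow_eq_of_coprime {n m : ℕ} (h : n.Coprime m) {s t : ℂ} (hs : ‖s‖ = 1)
    (ht : ‖t‖ = 1) (hst : s ^ m = t ^ n) : ∃ ζ : ℂ, ‖ζ‖ = 1 ∧ ζ ^ n = s ∧ ζ ^ m = t := by
  have hs0 : s ≠ 0 := norm_ne_zero_iff.1 (by rw [hs]; exact one_ne_zero)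
  have ht0 : t ≠ 0 := norm_ne_zero_iff.1 (by rw [ht]; exact one_ne_zero)
  have hbez : (n : ℤ) * n.gcdA m + m * n.gcdB m = 1 := by
    rw [← Nat.gcd_eq_gcd_ab, h.gcd_eq_one, Nat.cast_one]
  have hst' : s ^ (m : ℤ) = t ^ (n : ℤ) := by simpa using hst
  -- With Bézout coefficients `n u + m v = 1`, a solution `ζ` must equal `s ^ u * t ^ v`.
  refine ⟨s ^ n.gcdA m * t ^ n.gcdB m, by simp [hs, ht], ?_, ?_⟩
  · calc (s ^ n.gcdA m * t ^ n.gcdB m) ^ n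
        = s ^ ((n : ℤ) * n.gcdA m) * (t ^ (n : ℤ)) ^ n.gcdB m := by
          rw [mul_pow, ← zpow_natCast, ← zpow_natCast, ← zpow_mul, ← zpow_mul, ← zpow_mul,
            mul_comm (n.gcdA m), mul_comm (n.gcdB m)]
      _ = s ^ ((n : ℤ) * n.gcdA m + m * n.gcdB m) := by
          rw [← hst', ← zpow_mul, zpow_add₀ hs0]
      _ = s := by rw [hbez, zpow_one]
  · calc (s ^ n.gcdA m * t ^ n.gcdB m) ^ m
        = (s ^ (m : ℤ)) ^ n.gcdA m * t ^ ((m : ℤ) * n.gcdB m) := by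
          rw [mul_pow, ← zpow_natCast, ← zpow_natCast, ← zpow_mul, ← zpow_mul, ← zpow_mul,
            mul_comm (n.gcdA m), mul_comm (n.gcdB m)]
      _ = t ^ ((n : ℤ) * n.gcdA m + m * n.gcdB m) := by
          rw [hst', ← zpow_mul, zpow_add₀ ht0]
      _ = t := by rw [hbez, zpow_one]

/-! ### Torus charts. -/

/-- The map `ℂ → ℂ²` which in polar coordinates is `(r, t) ↦ (A r e^{int}, B r^α e^{imt})`, with
the first component placed at the index `i`. -/
def torusChart (i : Fin 2) (A B : ℂ) (α : ℝ) (n m : ℕ) (w : ℂ) : EuclideanSpace ℂ (Fin 2) :=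
  WithLp.toLp 2 (Function.update (fun _ => B * twist α m w) i (A * twist 1 n w))

section TorusChart

variable {i j : Fin 2} {A B : ℂ} {α : ℝ} {n m : ℕ}

theorem torusChart_fst (w : ℂ) : torusChart i A B α n m w i = A * twist 1 n w := by
  simp [torusChart]

theorem torusChart_snd (hij : i ≠ j) (w : ℂ) : torusChart i A B α n m w j = B * twist α m w := by
  simp [torusChart, hij.symm]

theorem torusChart_zero (hα : α ≠ 0) : torusChart i A B α n m 0 = 0 := by
  ext k
  rcases eq_or_ne i k with rfl | hik
  · simp [torusChart_fst, twist_zero one_ne_zero]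
  · simp [torusChart_snd hik, twist_zero hα]

theorem norm_torusChart_fst (hA : ‖A‖ = 1) (w : ℂ) : ‖torusChart i A B α n m w i‖ = ‖w‖ := by
  rw [torusChart_fst, norm_mul, hA, one_mul, norm_twist_one]

theorem continuous_torusChart (hα : 0 < α) : Continuous (torusChart i A B α n m) := by
  have h1 := continuous_twist one_pos n
  have h2 := continuous_twist hα m
  unfold torusChart
  fun_prop

/-- The component at `i` recovers `‖w‖`; the two directions recover the `n`-th and `m`-th powers of
`dir w`, which determine it by coprimality. -/
theorem injective_torusChart (hij : i ≠ j) (hA : ‖A‖ = 1) (hB : ‖B‖ = 1)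
    (hnm : n.Coprime m) : Function.Injective (torusChart i A B α n m) := by
  intro w w' h
  have hnorm : ‖w‖ = ‖w'‖ := by
    rw [← norm_torusChart_fst (i := i) (B := B) (α := α) (n := n) (m := m) hA w, h,
      norm_torusChart_fst hA]
  rcases eq_or_ne w' 0 with rfl | hw'
  · simpa using hnorm
  have hw : w ≠ 0 := by
    rw [← norm_ne_zero_iff, hnorm]
    exact norm_ne_zero_iff.2 hw'
  have hA0 : A ≠ 0 := norm_ne_zero_iff.1 (by rw [hA]; exact one_ne_zero)
  have hB0 : B ≠ 0 := norm_ne_zero_iff.1 (by rw [hB]; exact one_ne_zero)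
  have hi := congrArg (fun z => dir (z i)) h
  have hj := congrArg (fun z => dir (z j)) h
  simp only [torusChart_fst, torusChart_snd hij, dir_mul_twist hA hw, dir_mul_twist hA hw',
    dir_mul_twist hB hw, dir_mul_twist hB hw'] at hi hj
  have hd' := dir_ne_zero hw'
  have hone : dir w / dir w' = 1 := by
    refine pow_eq_one_of_coprime hnm ?_ ?_
    · rw [div_pow, mul_left_cancel₀ hA0 hi, div_self (pow_ne_zero _ hd')]
    · rw [div_pow, mul_left_cancel₀ hB0 hj, div_self (pow_ne_zero _ hd')]
  rw [div_eq_one_iff_eq hd'] at hone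
  rw [← norm_mul_dir w, ← norm_mul_dir w', hone, hnorm]

/-- The norm of the chart is at least `‖w‖`, so the chart is proper, hence closed. -/
theorem isEmbedding_torusChart (hij : i ≠ j) (hA : ‖A‖ = 1) (hB : ‖B‖ = 1) (hα : 0 < α)
    (hnm : n.Coprime m) : IsEmbedding (torusChart i A B α n m) := by
  have hproper : IsProperMap (torusChart i A B α n m) := by
    refine isProperMap_iff_tendsto_cocompact.2 ⟨continuous_torusChart hα, ?_⟩
    rw [← Metric.cobounded_eq_cocompact, ← Metric.cobounded_eq_cocompact,
      ← tendsto_norm_atTop_iff_cobounded]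
    refine tendsto_atTop_mono (fun w => ?_) tendsto_norm_cobounded_atTop
    rw [← norm_torusChart_fst (i := i) (B := B) (α := α) (n := n) (m := m) hA w]
    exact PiLp.norm_apply_le _ i
  exact (IsClosedEmbedding.of_continuous_injective_isClosedMap (continuous_torusChart hα)
    (injective_torusChart hij hA hB hnm) hproper.isClosedMap).isEmbedding

theorem exists_lipschitzOnWith_torusChart (hij : i ≠ j) (hA : ‖A‖ = 1) (hB : ‖B‖ = 1)
    (hα : 1 ≤ α) :
    ∃ K : ℝ≥0, LipschitzOnWith K (torusChart i A B α n m) (Metric.ball 0 1) := by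
  obtain ⟨K, hK⟩ := exists_lipschitzOnWith_twist le_rfl n
  obtain ⟨L, hL⟩ := exists_lipschitzOnWith_twist hα m
  refine ⟨K + L, LipschitzOnWith.of_dist_le_mul fun w hw w' hw' => ?_⟩
  have h1 := hK.dist_le_mul w hw w' hw'
  have h2 := hL.dist_le_mul w hw w' hw'
  rw [dist_eq_norm] at h1 h2
  rw [dist_eq_norm]
  refine (norm_le_add_norm_apply hij _).trans ?_
  rw [PiLp.sub_apply, PiLp.sub_apply, torusChart_fst, torusChart_fst, torusChart_snd hij,
    torusChart_snd hij, ← mul_sub, ← mul_sub, norm_mul, norm_mul, hA, hB]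
  push_cast
  linarith

theorem eventually_edist_le_torusChart (hA : ‖A‖ = 1) (hn : n ≠ 0) (w : ℂ) :
    ∀ᶠ w' in 𝓝 w,
      edist w w' ≤ 5 * edist (torusChart i A B α n m w) (torusChart i A B α n m w') := by
  filter_upwards [eventually_norm_sub_le_twist hn w] with w' hw'
  have h := PiLp.norm_apply_le (torusChart i A B α n m w - torusChart i A B α n m w') i
  rw [PiLp.sub_apply, torusChart_fst, torusChart_fst, ← mul_sub, norm_mul, hA, one_mul] at h
  rw [edist_dist, edist_dist, dist_eq_norm, dist_eq_norm, ← ENNReal.ofReal_ofNat,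
    ← ENNReal.ofReal_mul (by norm_num)]
  exact ENNReal.ofReal_le_ofReal (by linarith)

theorem exists_isDiscChart_torusChart (hij : i ≠ j) (hA : ‖A‖ = 1) (hB : ‖B‖ = 1) (hα : 1 ≤ α)
    (hn : n ≠ 0) (hnm : n.Coprime m) :
    ∃ K : ℝ≥0, IsDiscChart (torusChart i A B α n m) K (range (torusChart i A B α n m))
      {z : EuclideanSpace ℂ (Fin 2) | ‖z i‖ < 1} := by
  obtain ⟨K, hK⟩ := exists_lipschitzOnWith_torusChart (n := n) (m := m) hij hA hB hα
  -- One nonzero constant serves both the Lipschitz bound `K` and the expansion bound 5.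
  refine ⟨K + 5, by positivity, isEmbedding_torusChart hij hA hB (one_pos.trans_le hα) hnm,
    isOpen_lt (by fun_prop) continuous_const, ?_, hK.weaken le_self_add, fun w => ?_⟩
  · ext z
    constructor
    · rintro ⟨w, hw, rfl⟩
      refine ⟨mem_range_self w, ?_⟩
      rw [mem_ofPred_eq, norm_torusChart_fst hA]
      simpa using hw
    · rintro ⟨⟨w, rfl⟩, hw⟩
      rw [mem_ofPred_eq, norm_torusChart_fst hA] at hw
      exact ⟨w, by simpa using hw, rfl⟩
  · filter_upwards [eventually_edist_le_torusChart (i := i) (B := B) (α := α) (m := m) hA hn w]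
      with w' hw'
    refine hw'.trans ?_
    gcongr
    push_cast
    exact le_add_self

end TorusChart

/-! ### Connected components. -/

/-- The points of `ℂ²` off the axes, with coordinates `u = z i` and `v = z j`, such that
`|v| = |u| ^ α` and the directions of `u` and `v` satisfy `u ^ k = - v ^ l`. -/
def torusCone (i j : Fin 2) (α : ℝ) (k l : ℕ) : Set (EuclideanSpace ℂ (Fin 2)) :=
  {z | z i ≠ 0 ∧ z j ≠ 0 ∧ ‖z j‖ = ‖z i‖ ^ α ∧ dir (z i) ^ k = -dir (z j) ^ l}

/-- The quotient `dir (z i) ^ m / dir (z j) ^ n` is a `d`-th root of `-1`, so it is constant on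
components; each of its level sets is the image of a connected punctured plane. -/
theorem connectedComponentIn_torusCone {i j : Fin 2} (hij : i ≠ j) {α : ℝ} (hα : 0 < α)
    {n m d : ℕ} (hd : d ≠ 0) (hnm : n.Coprime m) {x : EuclideanSpace ℂ (Fin 2)}
    (hx : x ∈ torusCone i j α (m * d) (n * d)) :
    connectedComponentIn (torusCone i j α (m * d) (n * d)) x =
      torusChart i (dir (x i)) (dir (x j)) α n m '' {0}ᶜ := by
  obtain ⟨hxi, hxj, hxn, hxd⟩ := id hx
  have hA := norm_dir hxi
  have hB := norm_dir hxj
  -- Used to see that `x` itself has the parameter `‖x i‖`.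
  have hpow : ∀ r : ℝ, 0 < r → ∀ k : ℕ, ∀ β : ℝ, twist β k r = (r ^ β : ℝ) := by
    intro r hr k β
    have h1 : dir (r : ℂ) = 1 := by simpa using dir_ofReal_mul hr (norm_one (α := ℂ))
    rw [twist, h1, one_pow, mul_one, Complex.norm_real, Real.norm_of_nonneg hr.le]
  apply Subset.antisymm
  · intro z hz
    have hsub := connectedComponentIn_subset (torusCone i j α (m * d) (n * d)) x
    obtain ⟨hzi, hzj, hzn, hzd⟩ := hsub hz
    let G : EuclideanSpace ℂ (Fin 2) → ℂ := fun z => dir (z i) ^ m / dir (z j) ^ n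
    have hG : ContinuousOn G (torusCone i j α (m * d) (n * d)) := by
      rintro y ⟨hyi, hyj, -⟩
      refine ContinuousAt.continuousWithinAt (ContinuousAt.div ?_ ?_ ?_)
      · exact (ContinuousAt.comp (f := fun y : EuclideanSpace ℂ (Fin 2) => y i)
          (continuousAt_dir hyi) (by fun_prop)).pow m
      · exact (ContinuousAt.comp (f := fun y : EuclideanSpace ℂ (Fin 2) => y j)
          (continuousAt_dir hyj) (by fun_prop)).pow n
      · exact pow_ne_zero _ (dir_ne_zero hyj)
    have hfin : {y : ℂ | y ^ d = -1}.Finite := by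
      refine (Polynomial.nthRoots d (-1 : ℂ)).toFinset.finite_toSet.subset fun y hy => ?_
      simpa [Polynomial.mem_nthRoots (Nat.pos_of_ne_zero hd)] using hy
    have himage : G '' connectedComponentIn (torusCone i j α (m * d) (n * d)) x ⊆
        {y : ℂ | y ^ d = -1} := by
      rintro _ ⟨y, hy, rfl⟩
      obtain ⟨-, hyj, -, hyd⟩ := hsub hy
      rw [mem_ofPred_eq, div_pow, ← pow_mul, ← pow_mul, hyd, neg_div,
        div_self (pow_ne_zero _ (dir_ne_zero hyj))]
    have heq : G z = G x := hfin.countable.isTotallyDisconnected _ himage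
      (isPreconnected_connectedComponentIn.image G (hG.mono hsub)) (mem_image_of_mem G hz)
      (mem_image_of_mem G (mem_connectedComponentIn hx))
    -- Equality of the quotients at `z` and `x` says that the ratios of directions satisfy `s ^ m =
    -- t ^ n`.
    obtain ⟨ζ, hζ, hζn, hζm⟩ := exists_pow_eq_pow_eq_of_coprime hnm
      (s := dir (z i) / dir (x i)) (t := dir (z j) / dir (x j))
      (by rw [norm_div, norm_dir hzi, hA, div_one]) (by rw [norm_div, norm_dir hzj, hB, div_one])
      (by
        have h1 := pow_ne_zero n (dir_ne_zero hxj)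
        have h2 := pow_ne_zero m (dir_ne_zero hxi)
        have h3 := pow_ne_zero n (dir_ne_zero hzj)
        simp only [G] at heq
        rw [div_eq_div_iff h3 h1] at heq
        rw [div_pow, div_pow, div_eq_div_iff h2 h1, heq, mul_comm])
    have hri := norm_pos_iff.2 hzi
    have hdir : dir (‖z i‖ * ζ) = ζ := dir_ofReal_mul hri hζ
    have hnorm : ‖(‖z i‖ : ℂ) * ζ‖ = ‖z i‖ := by
      rw [norm_mul, hζ, mul_one, Complex.norm_real, norm_norm]
    refine ⟨‖z i‖ * ζ, ?_, ?_⟩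
    · rw [mem_compl_singleton_iff, ← norm_ne_zero_iff, hnorm]
      exact hri.ne'
    · ext k
      rcases eq_or_eq_of_ne hij k with rfl | rfl
      · rw [torusChart_fst, twist, hdir, hnorm, hζn, Real.rpow_one, mul_left_comm,
          mul_div_cancel₀ _ (dir_ne_zero hxi), norm_mul_dir]
      · rw [torusChart_snd hij, twist, hdir, hnorm, hζm, ← hzn, mul_left_comm,
          mul_div_cancel₀ _ (dir_ne_zero hxj), norm_mul_dir]
  · refine IsPreconnected.subset_connectedComponentIn ?_ ?_ ?_
    · exact (isConnected_compl_singleton_of_one_lt_rank (by simp) 0).isPreconnected.image _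
        (continuous_torusChart hα).continuousOn
    · refine ⟨‖x i‖, by simpa using hxi, ?_⟩
      ext k
      have hri := norm_pos_iff.2 hxi
      rcases eq_or_eq_of_ne hij k with rfl | rfl
      · rw [torusChart_fst, hpow _ hri, Real.rpow_one, mul_comm, norm_mul_dir]
      · rw [torusChart_snd hij, hpow _ hri, ← hxn, mul_comm, norm_mul_dir]
    · rintro _ ⟨w, hw, rfl⟩
      have hw : w ≠ 0 := hw
      have hni : ‖torusChart i (dir (x i)) (dir (x j)) α n m w i‖ = ‖w‖ := norm_torusChart_fst hA w
      have hnj : ‖torusChart i (dir (x i)) (dir (x j)) α n m w j‖ = ‖w‖ ^ α := by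
        rw [torusChart_snd hij, norm_mul, hB, one_mul, norm_twist hα.ne']
      have hwpos := norm_pos_iff.2 hw
      refine ⟨?_, ?_, by rw [hni, hnj], ?_⟩
      · rw [← norm_ne_zero_iff, hni]
        exact hwpos.ne'
      · rw [← norm_ne_zero_iff, hnj]
        exact (Real.rpow_pos_of_pos hwpos _).ne'
      · rw [torusChart_fst, torusChart_snd hij, dir_mul_twist hA hw, dir_mul_twist hB hw, mul_pow,
          mul_pow, hxd, ← pow_mul, ← pow_mul]
        ring

/-! ### The surface in polar coordinates. -/

theorem pow_mul_conj_pow (z : ℂ) (a b : ℕ) :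
    z ^ (a + b) * conj z ^ b = (‖z‖ ^ (a + 2 * b) : ℝ) * dir z ^ a := by
  have h : z ^ a = ‖z‖ ^ a * dir z ^ a := by rw [← mul_pow, norm_mul_dir]
  rw [pow_add, mul_assoc, ← mul_pow, Complex.mul_conj, Complex.normSq_eq_norm_sq, h]
  push_cast
  ring

theorem norm_pow_mul_dir_pow {z : ℂ} (hz : z ≠ 0) (k a : ℕ) :
    ‖((‖z‖ ^ k : ℝ) : ℂ) * dir z ^ a‖ = ‖z‖ ^ k := by
  rw [norm_mul, norm_pow, norm_dir hz, one_pow, mul_one, Complex.norm_real,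
    Real.norm_of_nonneg (by positivity)]

theorem mem_surface_iff {a b : Fin 2 → ℕ} {i j : Fin 2} (hij : i ≠ j)
    (z : EuclideanSpace ℂ (Fin 2)) :
    z ∈ surface a b ↔ ((‖z i‖ ^ (a i + 2 * b i) : ℝ) : ℂ) * dir (z i) ^ a i =
      -(((‖z j‖ ^ (a j + 2 * b j) : ℝ) : ℂ) * dir (z j) ^ a j) := by
  have huniv : (Finset.univ : Finset (Fin 2)) = {i, j} := by
    ext k
    simpa using eq_or_eq_of_ne hij k
  rw [surface, mem_ofPred_eq, mixedPhamBrieskorn, huniv, Finset.sum_pair hij, pow_mul_conj_pow,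
    pow_mul_conj_pow, eq_neg_iff_add_eq_zero]

/-- Both total degrees are positive, so if one coordinate vanishes the other does too. Off the axes,
taking norms separates moduli from directions. -/
theorem surface_diff_zero {a b : Fin 2 → ℕ} {i j : Fin 2} (hij : i ≠ j)
    (hi : a i + 2 * b i ≠ 0) (hj : a j + 2 * b j ≠ 0) :
    surface a b \ {0} =
      torusCone i j (((a i + 2 * b i : ℕ) : ℝ) / (a j + 2 * b j : ℕ)) (a i) (a j) := by
  ext z
  rw [Set.mem_sdiff, mem_singleton_iff, mem_surface_iff hij]
  set p := a i + 2 * b i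
  set q := a j + 2 * b j
  have hq' : (q : ℝ) ≠ 0 := by exact_mod_cast hj
  have hrpow : ‖z j‖ = ‖z i‖ ^ ((p : ℝ) / q) ↔ ‖z i‖ ^ p = ‖z j‖ ^ q := by
    rw [div_eq_mul_inv, Real.rpow_mul (norm_nonneg _), Real.rpow_natCast,
      Real.eq_rpow_inv (norm_nonneg _) (by positivity) hq', Real.rpow_natCast, eq_comm]
  constructor
  · rintro ⟨hz, hne⟩
    have hzero : ∀ k l : Fin 2, k ≠ l → a l + 2 * b l ≠ 0 → a k + 2 * b k ≠ 0 →
        ((‖z k‖ ^ (a k + 2 * b k) : ℝ) : ℂ) * dir (z k) ^ a k =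
          -(((‖z l‖ ^ (a l + 2 * b l) : ℝ) : ℂ) * dir (z l) ^ a l) → z k ≠ 0 := by
      intro k l hkl hl hk h h0
      refine hne ?_
      have hl0 : z l = 0 := by
        by_contra hl0
        rw [h0, norm_zero, zero_pow hk, Complex.ofReal_zero, zero_mul, zero_eq_neg] at h
        have := norm_pow_mul_dir_pow hl0 (a l + 2 * b l) (a l)
        rw [h, norm_zero] at this
        exact pow_ne_zero _ (norm_ne_zero_iff.2 hl0) this.symm
      ext e
      rcases eq_or_eq_of_ne hkl e with rfl | rfl
      · simpa using h0
      · simpa using hl0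
    have hzi := hzero i j hij hj hi hz
    have hzj := hzero j i hij.symm hi hj (by rw [hz, neg_neg])
    have hnorm := congrArg norm hz
    rw [norm_neg, norm_pow_mul_dir_pow hzi, norm_pow_mul_dir_pow hzj] at hnorm
    refine ⟨hzi, hzj, hrpow.2 hnorm, ?_⟩
    rw [hnorm, ← mul_neg] at hz
    exact mul_left_cancel₀ (by simpa using fun h => absurd h hzj) hz
  · rintro ⟨hzi, hzj, hn, hdir⟩
    refine ⟨?_, fun h => hzi (by simp [h])⟩
    rw [hdir, hrpow.1 hn, mul_neg]

/-- The index `i` carries the larger total degree, giving `α ≥ 1`, and `a j ≠ 0` gives `n ≠ 0`. The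
case `a i = 0` is included, with `n = 1` and `m = 0`. -/
theorem innerBiLipschitzEquiv_horn_one {a b : Fin 2 → ℕ} {i j : Fin 2} (hij : i ≠ j)
    (hj : a j ≠ 0) (hle : a j + 2 * b j ≤ a i + 2 * b i) {x : EuclideanSpace ℂ (Fin 2)}
    (hx : x ∈ surface a b \ {0}) :
    InnerBiLipschitzEquiv (insert 0 (connectedComponentIn (surface a b \ {0}) x)) 0
      (horn 1) 0 := by
  have hd : (a j).gcd (a i) ≠ 0 := Nat.gcd_ne_zero_left hj
  obtain ⟨n, hn⟩ := Nat.gcd_dvd_left (a j) (a i)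
  obtain ⟨m, hm⟩ := Nat.gcd_dvd_right (a j) (a i)
  have hnm : n.Coprime m := by
    have h := Nat.gcd_mul_left ((a j).gcd (a i)) n m
    rw [← hn, ← hm] at h
    exact mul_left_cancel₀ hd (by rw [← h, mul_one])
  rw [mul_comm] at hn hm
  have hn0 : n ≠ 0 := by
    rintro rfl
    exact hj (by rw [hn, zero_mul])
  rw [surface_diff_zero hij (by omega) (by omega)] at hx ⊢
  set α : ℝ := ((a i + 2 * b i : ℕ) : ℝ) / (a j + 2 * b j : ℕ)
  have hα : 1 ≤ α := by
    rw [one_le_div (by exact_mod_cast (by omega : 0 < a j + 2 * b j))]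
    exact_mod_cast hle
  have hα0 : 0 < α := one_pos.trans_le hα
  generalize (a j).gcd (a i) = d at *
  rw [hn, hm] at hx ⊢
  rw [connectedComponentIn_torusCone hij hα0 hd hnm hx]
  obtain ⟨K, hK⟩ := exists_isDiscChart_torusChart hij (norm_dir hx.1) (norm_dir hx.2.1) hα hn0 hnm
  have hrange : insert 0 (torusChart i (dir (x i)) (dir (x j)) α n m '' {0}ᶜ) =
      range (torusChart i (dir (x i)) (dir (x j)) α n m) := by
    rw [← image_univ, ← union_compl_self {(0 : ℂ)}, image_union, image_singleton,
      torusChart_zero hα0.ne', singleton_union]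
  have h := hK.innerBiLipschitzEquiv isDiscChart_coneChart
  rwa [torusChart_zero hα0.ne', coneChart_zero, ← hrange] at h

end MixedSurface

end

theorem mainTheorem11 (a b : Fin 2 → ℕ)
    (hab : MixedSurface.IsTypeOne a b ∨ MixedSurface.IsTypeTwo a b ∨
      MixedSurface.IsTypeFour a b ∨ MixedSurface.IsTypeFive a b)
    (x : EuclideanSpace ℂ (Fin 2)) (hx : x ∈ MixedSurface.surface a b \ {0}) :
    MixedSurface.InnerBiLipschitzEquiv
      (insert 0 (connectedComponentIn (MixedSurface.surface a b \ {0}) x)) 0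
      (MixedSurface.horn 1) 0 := by
  -- The dominant index `i` is 1 for types (1) and (2), and 0 for types (4) and (5).
  rcases hab with ⟨h1, h0, h⟩ | ⟨h1, h0, h⟩ | ⟨h1, h0, h⟩ | ⟨h1, h0, h⟩
  · exact MixedSurface.innerBiLipschitzEquiv_horn_one one_ne_zero (by omega) (by omega) hx
  · exact MixedSurface.innerBiLipschitzEquiv_horn_one one_ne_zero (by omega) (by omega) hx
  · exact MixedSurface.innerBiLipschitzEquiv_horn_one zero_ne_one (by omega) (by omega) hx
  · exact MixedSurface.innerBiLipschitzEquiv_horn_one zero_ne_one (by omega) (by omega) hx
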